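/- Let $F$ be a (right-continuous, nondecreasing) distribution function on an interval $I\subseteq\mathbb R$ with $\int_I dF=1$, and let $a:I\to\mathbb R$ be measurable with respect to $dF$, not $dF$-a.e. equal to a constant, and essentially bounded below. The expectation $\int_I a\,dF\in(-\infty,\infty]$ may be infinite. Put $$\xi:=\operatorname*{ess\,inf}_{x\in I}a(x)\in\mathbb R,\qquad H_\xi:=\int_I\frac{1}{a(x)-\xi}\,dF\in(0,\infty],$$ where the integrand is $+\infty$ where $a(x)=\xi$ (so that $H_\xi=\infty$ if $\int_{a(x)=\xi}dF>0$) and $1/H_\xi:=0$ if $H_\xi=\infty$. For $c>-\xi$ define $$\Psi(c):=\frac{1}{\int_I (a(x)+c)^{-1}\,dF}-c .$$ A Bernstein function is a $C^\infty$ function $\phi:(0,\infty)\to\mathbb R$ with a continuous extension to $[0,\infty)$ such that $\phi\ge 0$ and $(-1)^k\phi^{(k)}\le 0$ for every integer $k\ge1$. A function $f:(0,\infty)\to\mathbb R$ is a complete Bernstein function if there is a Bernstein function $\phi$ such that $f(x)=x^2\int_0^\infty e^{-sx}\phi(s)\,ds$ (with convergent integral) for all $x>0$. **Theorem.** The function $\Psi(c)-\xi-1/H_\xi$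 is a complete Bernstein function of the variable $t=c+\xi>0$; that is, $t\mapsto \Psi(t-\xi)-\xi-1/H_\xi$ $(t>0)$ is a complete Bernstein function. -/

import Mathlib

open MeasureTheory Set Filter Topology
open scoped ENNReal ContDiff

noncomputable section

/-- A Bernstein function: a smooth nonnegative function on `(0, ∞)` with a continuous extension
to `[0, ∞)` (a finite limit at `0⁺`), whose derivatives satisfy `(-1)^k f⁽ᵏ⁾ ≤ 0` for `k ≥ 1`.
Values of `f` outside `(0, ∞)` are irrelevant. -/
structure IsBernstein (f : ℝ → ℝ) : Prop where
  contDiffOn : ContDiffOn ℝ ∞ f (Ioi 0)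
  exists_limit_zero : ∃ l : ℝ, Tendsto f (𝓝[>] 0) (𝓝 l)
  nonneg : ∀ x : ℝ, 0 < x → 0 ≤ f x
  deriv_sign : ∀ k : ℕ, 1 ≤ k → ∀ x : ℝ, 0 < x → (-1 : ℝ) ^ k * iteratedDeriv k f x ≤ 0

/-- A complete Bernstein function: `f x = x² ∫₀^∞ e^{-s x} φ(s) ds` for all `x > 0`, with a
Bernstein function `φ`; the Laplace integral is required to converge. -/
def IsCompleteBernstein (f : ℝ → ℝ) : Prop :=
  ∃ φ : ℝ → ℝ, IsBernstein φ ∧ ∀ x : ℝ, 0 < x →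
    IntegrableOn (fun s : ℝ => Real.exp (-(s * x)) * φ s) (Ioi 0) ∧
    f x = x ^ 2 * ∫ s in Ioi (0 : ℝ), Real.exp (-(s * x)) * φ s

namespace ProfitGame

/-- The measure `dF` on the interval `I`. -/
def dF (F : StieltjesFunction ℝ) (I : Set ℝ) : Measure ℝ := F.measure.restrict I

/-- `ξ`, the essential infimum over `I` of the profit function `a` with respect to `dF`. -/
def xi (F : StieltjesFunction ℝ) (I : Set ℝ) (a : ℝ → ℝ) : ℝ := essInf a (dF F I)

/-- `H_ξ = ∫_I 1 / (a(x) - ξ) dF`, with values in `[0, ∞]`. The integrand is `∞` where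
`a(x) = ξ`, so `H_ξ = ∞` as soon as that set has positive mass. -/
def H (F : StieltjesFunction ℝ) (I : Set ℝ) (a : ℝ → ℝ) : ℝ≥0∞ :=
  ∫⁻ x, (ENNReal.ofReal (a x - xi F I a))⁻¹ ∂(dF F I)

/-- `Ψ(c) = 1 / ∫_I (a(x) + c)⁻¹ dF - c`, meant for `c > -ξ`. -/
def Psi (F : StieltjesFunction ℝ) (I : Set ℝ) (a : ℝ → ℝ) (c : ℝ) : ℝ :=
  1 / (∫ x, (a x + c)⁻¹ ∂(dF F I)) - c

end ProfitGame

end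

/-! With `Y = a - ξ ≥ 0` and `r(t) = 1 / ∫ (Y + t)⁻¹ dF`, the function in question is `r(t) - t -
1/H_ξ`. The target is a representation `∫ (1 + l) t / (t + l) dρ(l)` with `ρ` finite on `(0, ∞)`;
each such integrand is `t²` times the Laplace transform of a multiple of `1 - e^{-ls}`.

The measure comes from operator theory. Put `W = 1 / (1 + Y)`, a bounded operator even when `a` is
unbounded. On `L²(W dF)`, `1/r(t)` is the matrix coefficient of `(1 + (t - 1) W)⁻¹` at the constant
`1`. The reciprocal of such a coefficient is a Schur complement, governed by a spectral measure of
the compression of `W` to the orthogonal complement of `1` (`exists_schur_complement_measure`).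
Hence `r` is affine in `t` minus `(t - 1)² ∫ (1 + (t - 1) x)⁻¹ dν`, with `ν` on `[0, 1]`.

The limits `r(t)/t → 1` at infinity and `r(t) → 1/H_ξ` at zero determine the affine coefficients and
force `1/x` and `1/(1 - x)` to be `ν`-integrable (`isCompleteBernstein_sub_of_resolvent_form`). The
substitution `l = (1 - x)/x` then gives `ρ`. -/

/-! ### Spectral measures and the Schur complement. -/

-- Riesz–Markov on the compact spectrum: `f ↦ ⟪w, f(C) w⟫` is a positive functional.
open scoped CompactlySupported InnerProductSpace in
theorem IsSelfAdjoint.exists_spectral_measure {E : Type*} [NormedAddCommGroup E]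
    [InnerProductSpace ℂ E] [CompleteSpace E] {C : E →L[ℂ] E} (hC : IsSelfAdjoint C) (w : E) :
    ∃ ν : Measure ℝ, IsFiniteMeasure ν ∧ (∀ᵐ x ∂ν, x ∈ spectrum ℝ C) ∧
      ∀ f : ℝ → ℝ, ContinuousOn f (spectrum ℝ C) →
        (⟪w, cfc f C w⟫_ℂ).re = ∫ x, f x ∂ν := by
  classical
  let X := spectrum ℝ C
  have : CompactSpace X := isCompact_iff_compactSpace.mp (ContinuousFunctionalCalculus.isCompact_spectrum C)
  let L : C_c(X, ℝ) →ₗ[ℝ] ℝ :=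
    { toFun := fun f => (⟪w, cfcHom hC f.toContinuousMap w⟫_ℂ).re
      map_add' := fun f g => by
        have : (f + g).toContinuousMap = f.toContinuousMap + g.toContinuousMap := rfl
        simp [this]
      map_smul' := fun c f => by
        have : (c • f).toContinuousMap = c • f.toContinuousMap := rfl
        rw [this, map_smul, smul_apply, inner_smul_right_eq_smul]
        simp }
  have hL : ∀ f : C_c(X, ℝ), 0 ≤ f → 0 ≤ L f := by
    intro f hf
    have h1 : 0 ≤ cfcHom hC f.toContinuousMap := by
      rw [cfcHom_nonneg_iff hC]
      exact hf
    rw [ContinuousLinearMap.nonneg_iff_isPositive] at h1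
    exact h1.re_inner_nonneg_right w
  let Λ : C_c(X, ℝ) →ₚ[ℝ] ℝ := PositiveLinearMap.mk₀ L hL
  let ν := RealRMK.rieszMeasure Λ
  have hfin : IsFiniteMeasure ν := ⟨(isCompact_univ.measure_lt_top)⟩
  have hm : MeasurableSet X := (spectrum.isClosed (𝕜 := ℝ) C).measurableSet
  refine ⟨ν.map Subtype.val, inferInstance, ?_, ?_⟩
  · refine (ae_map_iff (p := (· ∈ X)) measurable_subtype_coe.aemeasurable hm).2 ?_
    exact Eventually.of_forall fun x => x.2
  · intro f hf
    rw [(MeasurableEmbedding.subtype_coe hm).integral_map, cfc_apply f C hC hf]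
    exact (RealRMK.integral_rieszMeasure Λ
      (CompactlySupportedContinuousMap.continuousMapEquiv ⟨_, hf.domRestrict⟩)).symm

-- Block elimination along `ℂ u ⊕ uᗮ`: solving for the `uᗮ` component of `z` involves only the
-- resolvent of the compression `C = Q W Q`. Here `G / ‖u‖²` is the coefficient of `z` along `u`.
open scoped InnerProductSpace in
theorem ContinuousLinearMap.exists_schur_complement_measure {E : Type*} [NormedAddCommGroup E]
    [InnerProductSpace ℂ E] [CompleteSpace E] {W : E →L[ℂ] E} (h0 : 0 ≤ W) (h1 : W ≤ 1)
    {u : E} (hu : u ≠ 0) :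
    ∃ ν : Measure ℝ, IsFiniteMeasure ν ∧ (∀ᵐ x ∂ν, x ∈ Icc (0 : ℝ) 1) ∧ ∃ κ : ℝ,
      ∀ (t : ℝ), 0 < t → ∀ z : E, z + (t - 1) • W z = u → ∀ G : ℝ, ⟪u, z⟫_ℂ = G →
        ‖u‖ ^ 2 = G * (1 + (t - 1) * κ - (t - 1) ^ 2 * ∫ x, (1 + (t - 1) * x)⁻¹ ∂ν) := by
  set Q : E →L[ℂ] E := (ℂ ∙ u)ᗮ.starProjection with hQ
  have hQsa : IsSelfAdjoint Q := isSelfAdjoint_starProjection _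
  have hQQ : ∀ x, Q (Q x) = Q x := fun x => by
    have := (Submodule.isIdempotentElem_starProjection (ℂ ∙ u)ᗮ)
    exact congrArg (fun T : E →L[ℂ] E => T x) this
  have hQu : Q u = 0 := by
    rw [hQ, Submodule.starProjection_orthogonal_val]
    simp [Submodule.starProjection_eq_self_iff.2 (Submodule.mem_span_singleton_self u)]
  have hQsym : ∀ x y, ⟪Q x, y⟫_ℂ = ⟪x, Q y⟫_ℂ := hQsa.isSymmetric
  have hWsym : ∀ x y, ⟪W x, y⟫_ℂ = ⟪x, W y⟫_ℂ :=
    ((ContinuousLinearMap.nonneg_iff_isPositive _).1 h0).isSelfAdjoint.isSymmetric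
  set C : E →L[ℂ] E := Q ∘L W ∘L Q with hCdef
  have hCpos : 0 ≤ C := by
    rw [ContinuousLinearMap.nonneg_iff_isPositive]
    exact ((ContinuousLinearMap.nonneg_iff_isPositive _).1 h0).conj_starProjection _
  have hC1 : C ≤ 1 := by
    have h2 : 0 ≤ Q ∘L (1 - W) ∘L Q := by
      rw [ContinuousLinearMap.nonneg_iff_isPositive]
      exact ((ContinuousLinearMap.nonneg_iff_isPositive _).1 (sub_nonneg.2 h1)).conj_starProjection _
    have h3 : 0 ≤ 1 - Q := by
      rw [ContinuousLinearMap.nonneg_iff_isPositive]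
      have : (1 : E →L[ℂ] E) - Q = (ℂ ∙ u).starProjection := by
        ext x
        simp [hQ, Submodule.starProjection_orthogonal_val]
      rw [this]
      exact ContinuousLinearMap.IsPositive.of_isStarProjection isStarProjection_starProjection
    rw [← sub_nonneg]
    have : 1 - C = Q ∘L (1 - W) ∘L Q + (1 - Q) := by
      ext x
      simp [hCdef, hQQ]
    rw [this]
    exact add_nonneg h2 h3
  have hCsa : IsSelfAdjoint C := IsSelfAdjoint.of_nonneg hCpos
  have hspec : spectrum ℝ C ⊆ Icc 0 1 := by
    intro x hx
    refine ⟨spectrum_nonneg_of_nonneg hCpos hx, ?_⟩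
    have := (le_algebraMap_iff_spectrum_le (R := ℝ) (r := 1) (a := C) hCsa).1 (by simpa using hC1)
    exact this x hx
  have hp : 0 < ‖u‖ := norm_pos_iff.2 hu
  -- This scaling makes `‖u‖²` a common factor, so that it cancels at the end.
  set w : E := (‖u‖⁻¹ : ℝ) • Q (W u) with hw
  obtain ⟨ν, hν, hsupp, hint⟩ := hCsa.exists_spectral_measure w
  refine ⟨ν, hν, hsupp.mono fun x hx => hspec hx, (⟪u, W u⟫_ℂ).re / ‖u‖ ^ 2, ?_⟩
  intro t ht z hz G hG
  have hne : ∀ x ∈ spectrum ℝ C, 1 + (t - 1) * x ≠ 0 := by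
    intro x hx
    obtain ⟨hx0, hx1⟩ := hspec hx
    have : 0 < 1 + (t - 1) * x := by
      rcases hx1.lt_or_eq with h | h
      · nlinarith [mul_nonneg ht.le hx0]
      · subst h; linarith
    exact this.ne'
  have hcont : ContinuousOn (fun x : ℝ => (1 + (t - 1) * x)⁻¹) (spectrum ℝ C) :=
    ContinuousOn.inv₀ (by fun_prop) hne
  have hR := hint _ hcont
  set R := cfc (fun x : ℝ => (1 + (t - 1) * x)⁻¹) C with hRdef
  have hRinv : R * (1 + (t - 1) • C) = 1 := by
    have h4 : (1 : E →L[ℂ] E) + (t - 1) • C = cfc (fun x : ℝ => 1 + (t - 1) * x) C := by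
      rw [cfc_add (a := C) (fun _ => (1 : ℝ)) (fun x => (t - 1) * x), cfc_const_mul (t - 1) (fun x : ℝ => x), cfc_id' ℝ C, cfc_const_one ℝ C]
    rw [h4, hRdef, ← cfc_mul _ _ C hcont (by fun_prop), ← cfc_const_one ℝ C]
    exact cfc_congr fun x hx => inv_mul_cancel₀ (hne x hx)
  set q := Q z with hq
  set g : ℝ := G / ‖u‖ ^ 2 with hg
  have hzdec : z = g • u + q := by
    have h5 : q = z - (ℂ ∙ u).starProjection z := by
      rw [hq, hQ, Submodule.starProjection_orthogonal_val]
    rw [h5, Submodule.starProjection_singleton, hG, hg]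
    rw [← Complex.coe_smul]
    push_cast
    simp
  -- Projecting the equation for `z` to `uᗮ` kills the right-hand side `u`.
  have hCq : q + (t - 1) • C q = -((t - 1) * g) • Q (W u) := by
    have h6 : Q z + (t - 1) • Q (W z) = 0 := by
      have := congrArg Q hz
      rwa [map_add, hQu, ContinuousLinearMap.map_smul_of_tower] at this
    have h7 : Q (W z) = g • Q (W u) + C q := by
      conv_lhs => rw [hzdec]
      simp [hCdef, hq, hQQ, ContinuousLinearMap.map_smul_of_tower]
    rw [h7] at h6
    calc q + (t - 1) • C q
        = (q + (t - 1) • (g • Q (W u) + C q)) - ((t - 1) * g) • Q (W u) := by module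
      _ = -((t - 1) * g) • Q (W u) := by rw [h6, zero_sub, neg_smul]
  have hq2 : q = -((t - 1) * g) • R (Q (W u)) := by
    have h8 : R (q + (t - 1) • C q) = q := by
      have := congrArg (fun T : E →L[ℂ] E => T q) hRinv
      simpa using this
    rw [← h8, hCq, ContinuousLinearMap.map_smul_of_tower]
  have hin : ⟪u, W z⟫_ℂ = g * ⟪u, W u⟫_ℂ - (t - 1) * g * ⟪Q (W u), R (Q (W u))⟫_ℂ := by
    have h9 : ⟪u, W q⟫_ℂ = ⟪Q (W u), q⟫_ℂ := by
      rw [hQsym, ← hWsym, hq, hQQ]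
    conv_lhs => rw [hzdec]
    rw [map_add, inner_add_right, h9]
    conv_lhs => rw [hq2]
    rw [ContinuousLinearMap.map_smul_of_tower, inner_smul_right_eq_smul, inner_smul_right_eq_smul]
    simp only [Complex.real_smul]
    push_cast
    ring
  have hRw : (⟪Q (W u), R (Q (W u))⟫_ℂ).re = ‖u‖ ^ 2 * ∫ x, (1 + (t - 1) * x)⁻¹ ∂ν := by
    rw [← hR, hw, ContinuousLinearMap.map_smul_of_tower, inner_smul_right_eq_smul,
      inner_smul_left_eq_smul]
    simp only [Complex.real_smul, Complex.re_ofReal_mul]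
    field_simp
  have hfin : ⟪u, u⟫_ℂ = G + (t - 1) * ⟪u, W z⟫_ℂ := by
    have := congrArg (fun x => ⟪u, x⟫_ℂ) hz
    simp only [inner_add_right, hG, inner_smul_right_eq_smul, Complex.real_smul] at this
    rw [← this]
    push_cast
    ring
  have hre := congrArg Complex.re hfin
  rw [hin] at hre
  have huu : (⟪u, u⟫_ℂ).re = ‖u‖ ^ 2 := inner_self_eq_norm_sq (𝕜 := ℂ) u
  have hexp : ((G : ℂ) + (t - 1) * (g * ⟪u, W u⟫_ℂ - (t - 1) * g * ⟪Q (W u), R (Q (W u))⟫_ℂ)).re =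
      G + (t - 1) * (g * (⟪u, W u⟫_ℂ).re - (t - 1) * g * (⟪Q (W u), R (Q (W u))⟫_ℂ).re) := by
    have hc : ((t : ℂ) - 1) = ((t - 1 : ℝ) : ℂ) := by push_cast; rfl
    rw [hc, ← Complex.ofReal_mul]
    simp only [Complex.add_re, Complex.sub_re, Complex.re_ofReal_mul, Complex.ofReal_re]
  rw [huu, hexp, hRw] at hre
  refine hre.trans ?_
  rw [hg]
  field_simp
  ring

-- The Schur complement for multiplication by `W` on `L²(m)`, with `u = 1` and `z = (1 + (t - 1)
-- W)⁻¹`; dividing by `‖u‖² = m(Ω)` rescales `ν`.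
open scoped InnerProductSpace in
theorem MeasureTheory.exists_measure_inv_integral_resolvent {Ω : Type*} [MeasurableSpace Ω]
    {m : Measure Ω} [IsFiniteMeasure m] (hm : m ≠ 0) {W : Ω → ℝ} (hW : AEMeasurable W m)
    (hW01 : ∀ᵐ x ∂m, W x ∈ Icc (0 : ℝ) 1) :
    ∃ ν : Measure ℝ, IsFiniteMeasure ν ∧ (∀ᵐ x ∂ν, x ∈ Icc (0 : ℝ) 1) ∧ ∃ A B : ℝ,
      ∀ t : ℝ, 0 < t → (∫ x, (1 + (t - 1) * W x)⁻¹ ∂m)⁻¹ =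
        A + (t - 1) * B - (t - 1) ^ 2 * ∫ x, (1 + (t - 1) * x)⁻¹ ∂ν := by
  have hbd : ∀ f : Ω → ℝ, AEMeasurable f m → (∃ c : ℝ, ∀ᵐ x ∂m, |f x| ≤ c) → ∀ p : ℝ≥0∞,
      MemLp (fun x => (f x : ℂ)) p m := fun f hf ⟨c, hc⟩ p =>
    MemLp.of_bound (Complex.measurable_ofReal.comp_aemeasurable hf).aestronglyMeasurable c
      (by simpa using hc)
  have hWL : MemLp (fun x => (W x : ℂ)) ∞ m := hbd W hW
    ⟨1, hW01.mono fun x hx => abs_le.2 ⟨by linarith [hx.1], hx.2⟩⟩ _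
  have h1L : MemLp (fun _ => ((1 : ℝ) : ℂ)) 2 m := hbd _ aemeasurable_const ⟨1, by simp⟩ _
  let T : Lp ℂ 2 m →L[ℂ] Lp ℂ 2 m := (ContinuousLinearMap.mul ℂ ℂ).holderL m ∞ 2 2 hWL.toLp
  have hT : ∀ f : Lp ℂ 2 m, T f =ᵐ[m] fun x => (W x : ℂ) * f x := fun f => by
    filter_upwards [(ContinuousLinearMap.mul ℂ ℂ).coeFn_holder (r := 2) hWL.toLp f, hWL.coeFn_toLp]
      with x hx h2
    simpa [T, h2] using hx
  have hpos : ∀ (S : Lp ℂ 2 m →L[ℂ] Lp ℂ 2 m) (V : Ω → ℝ), (∀ᵐ x ∂m, 0 ≤ V x) →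
      (∀ f : Lp ℂ 2 m, S f =ᵐ[m] fun x => (V x : ℂ) * f x) → 0 ≤ S := by
    intro S V hV hS
    rw [ContinuousLinearMap.nonneg_iff_isPositive, ContinuousLinearMap.isPositive_iff]
    have key : ∀ f g : Lp ℂ 2 m, ⟪S f, g⟫_ℂ = ⟪f, S g⟫_ℂ := by
      intro f g
      rw [L2.inner_def, L2.inner_def]
      refine integral_congr_ae ?_
      filter_upwards [hS f, hS g] with x h1 h2
      simp [h1, h2]
      ring
    refine ⟨key, fun f => ?_⟩
    rw [L2.inner_def]
    have h3 : ∀ᵐ x ∂m, ⟪S f x, f x⟫_ℂ = ((V x * ‖f x‖ ^ 2 : ℝ) : ℂ) := by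
      filter_upwards [hS f] with x h1
      rw [h1, RCLike.inner_apply, map_mul, Complex.conj_ofReal, mul_left_comm, Complex.mul_conj']
      push_cast
      rfl
    rw [integral_congr_ae h3, integral_complex_ofReal]
    exact_mod_cast integral_nonneg_of_ae (hV.mono fun x hx => by positivity)
  have hT0 : 0 ≤ T := hpos T W (hW01.mono fun x hx => hx.1) hT
  have hT1 : T ≤ 1 := by
    rw [← sub_nonneg]
    refine hpos (1 - T) (fun x => 1 - W x) (hW01.mono fun x hx => sub_nonneg.2 hx.2) fun f => ?_
    filter_upwards [hT f, Lp.coeFn_sub f (T f)] with x h1 h2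
    rw [show (1 - T) f = f - T f from rfl, h2, Pi.sub_apply, h1]
    push_cast
    ring
  set u : Lp ℂ 2 m := h1L.toLp with hu
  have hunorm : ‖u‖ ^ 2 = m.real univ := by
    have : (⟪u, u⟫_ℂ).re = ‖u‖ ^ 2 := inner_self_eq_norm_sq (𝕜 := ℂ) u
    rw [← this, L2.inner_def]
    have h3 : ∀ᵐ x ∂m, ⟪u x, u x⟫_ℂ = 1 := by
      filter_upwards [h1L.coeFn_toLp] with x h1
      rw [hu, h1]
      simp
    rw [integral_congr_ae h3]
    simp
  have hmpos : 0 < m.real univ :=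
    ENNReal.toReal_pos (by simpa using hm) (measure_ne_top _ _)
  have hu0 : u ≠ 0 := by
    rintro h
    rw [h] at hunorm
    simp at hunorm
    linarith
  obtain ⟨ν, hν, hsupp, κ, h⟩ := ContinuousLinearMap.exists_schur_complement_measure hT0 hT1 hu0
  refine ⟨ENNReal.ofReal (m.real univ)⁻¹ • ν, Measure.smul_finite _ ENNReal.ofReal_ne_top, ?_, (m.real univ)⁻¹,
    (m.real univ)⁻¹ * κ, fun t ht => ?_⟩
  · exact Measure.ae_smul_measure hsupp _
  have hden : ∀ᵐ x ∂m, min t 1 ≤ 1 + (t - 1) * W x := by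
    filter_upwards [hW01] with x hx
    rcases le_total t 1 with h | h
    · rw [min_eq_left h]; nlinarith [hx.1, hx.2]
    · rw [min_eq_right h]; nlinarith [hx.1, hx.2]
  have hmin : 0 < min t 1 := lt_min ht one_pos
  have hzL : MemLp (fun x => (((1 + (t - 1) * W x)⁻¹ : ℝ) : ℂ)) 2 m := by
    refine hbd _ (by fun_prop) ⟨(min t 1)⁻¹, hden.mono fun x hx => ?_⟩ _
    rw [abs_of_nonneg (inv_nonneg.2 (hmin.le.trans hx))]
    exact inv_anti₀ hmin hx
  have hz : hzL.toLp + (t - 1) • T hzL.toLp = u := by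
    refine Lp.ext ?_
    filter_upwards [Lp.coeFn_add hzL.toLp ((t - 1) • T hzL.toLp), Lp.coeFn_smul (t - 1) (T hzL.toLp),
      hT hzL.toLp, hzL.coeFn_toLp, h1L.coeFn_toLp, hden] with x h1 h2 h3 h4 h5 h6
    have h7 : 1 + (t - 1) * W x ≠ 0 := (hmin.trans_le h6).ne'
    rw [h1, Pi.add_apply, h2, Pi.smul_apply, h3, h4, hu, h5, Complex.real_smul]
    norm_cast
    field_simp
  have hG := h t ht hzL.toLp hz (∫ x, (1 + (t - 1) * W x)⁻¹ ∂m) (by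
    rw [L2.inner_def, ← integral_complex_ofReal]
    refine integral_congr_ae ?_
    filter_upwards [hzL.coeFn_toLp, h1L.coeFn_toLp] with x h4 h5
    rw [h4, hu, h5]
    simp)
  rw [hunorm] at hG
  rw [integral_smul_measure, ENNReal.toReal_ofReal (inv_nonneg.2 hmpos.le)]
  have hGne : (∫ x, (1 + (t - 1) * W x)⁻¹ ∂m) ≠ 0 := by
    intro h0
    rw [h0, zero_mul] at hG
    exact hmpos.ne' hG
  rw [smul_eq_mul, inv_eq_of_mul_eq_one_right]
  calc _ = (m.real univ)⁻¹ * ((∫ x, (1 + (t - 1) * W x)⁻¹ ∂m) *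
      (1 + (t - 1) * κ - (t - 1) ^ 2 * ∫ x, (1 + (t - 1) * x)⁻¹ ∂ν)) := by ring
    _ = 1 := by rw [← hG]; exact inv_mul_cancel₀ hmpos.ne'

/-! ### Mixtures of `1 - e^{-ls}` as Bernstein functions. -/

theorem Real.pow_mul_exp_neg_mul_le {l d : ℝ} (hl : 0 ≤ l) (hd : 0 < d) (n : ℕ) :
    l ^ n * Real.exp (-(l * d)) ≤ n.factorial / d ^ n := by
  have h := Real.pow_div_factorial_le_exp (l * d) (by positivity) n
  rw [Real.exp_neg, ← div_eq_mul_inv, div_le_div_iff₀ (Real.exp_pos _) (by positivity), ← mul_pow]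
  rw [div_le_iff₀ (by positivity)] at h
  linarith

/-- The `k`-th moment integral `∫ (1 + l) lᵏ e^{-ls} dρ(l)`. -/
noncomputable def expMoment (ρ : Measure ℝ) (k : ℕ) (s : ℝ) : ℝ :=
  ∫ l, (1 + l) * l ^ k * Real.exp (-(l * s)) ∂ρ

/-- The Bernstein function with Lévy measure `(1 + l) / l • ρ`, written in terms of the
rates `l` of its exponentials. -/
noncomputable def expMixture (ρ : Measure ℝ) (s : ℝ) : ℝ :=
  ∫ l, (1 - Real.exp (-(l * s))) * ((1 + l) / l) ∂ρ

theorem Real.one_sub_exp_mul_nonneg {l s : ℝ} (hl : 0 < l) (hs : 0 ≤ s) :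
    0 ≤ (1 - Real.exp (-(l * s))) * ((1 + l) / l) := by
  have : Real.exp (-(l * s)) ≤ 1 := Real.exp_le_one_iff.2 (by nlinarith)
  have : 0 ≤ 1 - Real.exp (-(l * s)) := by linarith
  positivity

theorem Real.one_sub_exp_mul_le {l s : ℝ} (hl : 0 < l) :
    (1 - Real.exp (-(l * s))) * ((1 + l) / l) ≤ s + 1 := by
  have h1 : 1 - Real.exp (-(l * s)) ≤ l * s := by linarith [Real.add_one_le_exp (-(l * s))]
  have h2 : 1 - Real.exp (-(l * s)) ≤ 1 := by linarith [Real.exp_pos (-(l * s))]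
  have : (1 - Real.exp (-(l * s))) * ((1 + l) / l) =
      (1 - Real.exp (-(l * s))) / l + (1 - Real.exp (-(l * s))) := by field_simp
  rw [this]
  have : (1 - Real.exp (-(l * s))) / l ≤ s := by rw [div_le_iff₀ hl]; linarith
  linarith

section Bernstein

variable {ρ : Measure ℝ} [IsFiniteMeasure ρ]

theorem norm_expMoment_integrand_le {l d s : ℝ} (hl : 0 < l) (hd : 0 < d) (hs : d ≤ s) (k : ℕ) :
    ‖(1 + l) * l ^ k * Real.exp (-(l * s))‖ ≤
      k.factorial / d ^ k + (k + 1).factorial / d ^ (k + 1) := by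
  rw [Real.norm_of_nonneg (by positivity)]
  have h1 := Real.pow_mul_exp_neg_mul_le hl.le hd k
  have h2 := Real.pow_mul_exp_neg_mul_le hl.le hd (k + 1)
  have h3 : Real.exp (-(l * s)) ≤ Real.exp (-(l * d)) := Real.exp_le_exp.2 (by nlinarith)
  calc (1 + l) * l ^ k * Real.exp (-(l * s)) ≤ (1 + l) * l ^ k * Real.exp (-(l * d)) := by gcongr
    _ = l ^ k * Real.exp (-(l * d)) + l ^ (k + 1) * Real.exp (-(l * d)) := by ring
    _ ≤ _ := add_le_add h1 h2

theorem hasDerivAt_expMoment (hρ : ∀ᵐ l ∂ρ, 0 < l) (k : ℕ) {s : ℝ} (hs : 0 < s) :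
    HasDerivAt (expMoment ρ k) (-expMoment ρ (k + 1) s) s := by
  have hs2 : 0 < s / 2 := by positivity
  have h := hasDerivAt_integral_of_dominated_loc_of_deriv_le (μ := ρ) (𝕜 := ℝ)
    (F := fun s l => (1 + l) * l ^ k * Real.exp (-(l * s)))
    (F' := fun s l => -((1 + l) * l ^ (k + 1) * Real.exp (-(l * s))))
    (x₀ := s) (s := Ioi (s / 2)) (Ioi_mem_nhds (by linarith))
    (bound := fun _ => (k + 1).factorial / (s / 2) ^ (k + 1) + (k + 2).factorial / (s / 2) ^ (k + 2))
    (Eventually.of_forall fun x => by fun_prop)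
    (Integrable.of_bound (by fun_prop) _
      (hρ.mono fun l hl => norm_expMoment_integrand_le hl hs le_rfl k))
    (by fun_prop)
    (hρ.mono fun l hl x hx => by
      rw [norm_neg]
      exact norm_expMoment_integrand_le hl hs2 (le_of_lt hx) (k + 1))
    (integrable_const _)
    (Eventually.of_forall fun l x _ => by
      have h1 : HasDerivAt (fun x : ℝ => -(l * x)) (-l) x := by
        have h := ((hasDerivAt_id x).const_mul l).neg
        rw [mul_one] at h
        exact h
      exact (h1.exp.const_mul ((1 + l) * l ^ k)).congr_deriv (by ring))
  have h2 := h.2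
  rw [integral_neg] at h2
  exact h2

theorem integrable_expMixture (hρ : ∀ᵐ l ∂ρ, 0 < l) {s : ℝ} (hs : 0 ≤ s) :
    Integrable (fun l => (1 - Real.exp (-(l * s))) * ((1 + l) / l)) ρ :=
  Integrable.of_bound (by fun_prop) (s + 1) (hρ.mono fun l hl => by
    rw [Real.norm_of_nonneg (Real.one_sub_exp_mul_nonneg hl hs)]
    exact Real.one_sub_exp_mul_le hl)

theorem hasDerivAt_expMixture (hρ : ∀ᵐ l ∂ρ, 0 < l) {s : ℝ} (hs : 0 < s) :
    HasDerivAt (expMixture ρ) (expMoment ρ 0 s) s := by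
  have hs2 : 0 < s / 2 := by positivity
  exact (hasDerivAt_integral_of_dominated_loc_of_deriv_le (μ := ρ) (𝕜 := ℝ)
    (F := fun s l => (1 - Real.exp (-(l * s))) * ((1 + l) / l))
    (F' := fun s l => (1 + l) * l ^ 0 * Real.exp (-(l * s)))
    (x₀ := s) (s := Ioi (s / 2)) (Ioi_mem_nhds (by linarith))
    (bound := fun _ => (0).factorial / (s / 2) ^ 0 + (0 + 1).factorial / (s / 2) ^ (0 + 1))
    (Eventually.of_forall fun x => by fun_prop)
    (integrable_expMixture hρ hs.le)
    (by fun_prop)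
    (hρ.mono fun l hl x hx => norm_expMoment_integrand_le hl hs2 (le_of_lt hx) 0)
    (integrable_const _)
    (hρ.mono fun l hl x _ => by
      have h1 : HasDerivAt (fun x : ℝ => -(l * x)) (-l) x := by
        have h := ((hasDerivAt_id x).const_mul l).neg
        rw [mul_one] at h
        exact h
      exact ((h1.exp.const_sub 1).mul_const ((1 + l) / l)).congr_deriv (by field_simp))).2

theorem contDiffOn_expMoment (hρ : ∀ᵐ l ∂ρ, 0 < l) (n : ℕ) (k : ℕ) : ContDiffOn ℝ n (expMoment ρ k) (Ioi 0) := by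
  induction n generalizing k with
  | zero =>
    rw [Nat.cast_zero, contDiffOn_zero]
    exact fun s hs => (hasDerivAt_expMoment hρ k hs).continuousAt.continuousWithinAt
  | succ n ih =>
    rw [Nat.cast_succ, contDiffOn_succ_iff_deriv_of_isOpen isOpen_Ioi]
    refine ⟨fun s hs => (hasDerivAt_expMoment hρ k hs).differentiableAt.differentiableWithinAt,
      by simp, ?_⟩
    exact (ih (k + 1)).neg.congr fun s hs => (hasDerivAt_expMoment hρ k hs).deriv

theorem contDiffOn_expMixture (hρ : ∀ᵐ l ∂ρ, 0 < l) : ContDiffOn ℝ ∞ (expMixture ρ) (Ioi 0) := by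
  rw [contDiffOn_infty]
  intro n
  refine ContDiffOn.of_le (n := n + 1) ?_ (by exact_mod_cast Nat.le_succ n)
  rw [contDiffOn_succ_iff_deriv_of_isOpen isOpen_Ioi]
  refine ⟨fun s hs => (hasDerivAt_expMixture hρ hs).differentiableAt.differentiableWithinAt,
      by simp, ?_⟩
  exact (contDiffOn_expMoment hρ n 0).congr fun s hs => (hasDerivAt_expMixture hρ hs).deriv

theorem iteratedDeriv_expMixture (hρ : ∀ᵐ l ∂ρ, 0 < l) (k : ℕ) {s : ℝ} (hs : 0 < s) :
    iteratedDeriv (k + 1) (expMixture ρ) s = (-1) ^ k * expMoment ρ k s := by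
  induction k generalizing s with
  | zero => simpa using (hasDerivAt_expMixture hρ hs).deriv
  | succ k ih =>
    rw [iteratedDeriv_succ]
    have : iteratedDeriv (k + 1) (expMixture ρ) =ᶠ[𝓝 s] fun s => (-1) ^ k * expMoment ρ k s :=
      by
      filter_upwards [Ioi_mem_nhds hs] with x hx using ih hx
    rw [this.deriv_eq, ((hasDerivAt_expMoment hρ k hs).const_mul _).deriv]
    ring

theorem isBernstein_expMixture (hρ : ∀ᵐ l ∂ρ, 0 < l) : IsBernstein (expMixture ρ) where
  contDiffOn := contDiffOn_expMixture hρ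
  exists_limit_zero := by
    refine ⟨0, ?_⟩
    have h : Tendsto (expMixture ρ) (𝓝[>] 0) (𝓝 (∫ _, 0 ∂ρ)) := by
      refine tendsto_integral_filter_of_dominated_convergence (fun _ => 2)
        (Eventually.of_forall fun s => by fun_prop) ?_ (integrable_const _) ?_
      · filter_upwards [Ioo_mem_nhdsGT (one_pos : (0 : ℝ) < 1)] with s hs
        filter_upwards [hρ] with l hl
        rw [Real.norm_of_nonneg (Real.one_sub_exp_mul_nonneg hl hs.1.le)]
        linarith [Real.one_sub_exp_mul_le (s := s) hl, hs.2]
      · filter_upwards with l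
        have : Continuous fun s : ℝ => (1 - Real.exp (-(l * s))) * ((1 + l) / l) := by fun_prop
        have h := this.tendsto 0
        simp only [mul_zero, neg_zero, Real.exp_zero, sub_self, zero_mul] at h
        exact h.mono_left nhdsWithin_le_nhds
    simpa using h
  nonneg s hs := integral_nonneg_of_ae (hρ.mono fun l hl => Real.one_sub_exp_mul_nonneg hl hs.le)
  deriv_sign k hk s hs := by
    obtain ⟨k, rfl⟩ := Nat.exists_eq_add_of_le' hk
    rw [iteratedDeriv_expMixture hρ k hs, ← mul_assoc, ← pow_add, show k + 1 + k = 2 * k + 1 by ring,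
      pow_succ, pow_mul]
    have : 0 ≤ expMoment ρ k s :=
      integral_nonneg_of_ae (hρ.mono fun l hl => by positivity)
    simpa using this

/-- Fubini and `∫₀^∞ e^{-sx} (1 - e^{-ls}) ds = 1/x - 1/(x + l)`. -/
theorem isCompleteBernstein_of_eq_integral (hρ : ∀ᵐ l ∂ρ, 0 < l)
    {f : ℝ → ℝ} (hf : ∀ t, 0 < t → f t = ∫ l, (1 + l) * t / (t + l) ∂ρ) : IsCompleteBernstein f := by
  refine ⟨expMixture ρ, isBernstein_expMixture hρ, fun x hx => ?_⟩
  set K : ℝ → ℝ → ℝ := fun s l =>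
    Real.exp (-(s * x)) * ((1 - Real.exp (-(l * s))) * ((1 + l) / l)) with hK
  have hexp : ∀ y : ℝ, 0 < y → IntegrableOn (fun s : ℝ => Real.exp (-(s * y))) (Ioi 0) := fun y hy => by
    simpa [mul_comm] using integrableOn_exp_mul_Ioi (a := -y) (by linarith) 0
  have hexpval : ∀ y : ℝ, 0 < y → ∫ s in Ioi (0 : ℝ), Real.exp (-(s * y)) = y⁻¹ := fun y hy => by
    have := integral_exp_mul_Ioi (a := -y) (by linarith) 0
    simp only [mul_zero, Real.exp_zero, neg_div_neg_eq, one_div] at this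
    rw [← this]
    simp [mul_comm]
  have hsexp : IntegrableOn (fun s : ℝ => Real.exp (-(s * x)) * (s + 1)) (Ioi 0) := by
    have h1 : IntegrableOn (fun s : ℝ => s * Real.exp (-(s * x))) (Ioi 0) := by
      have := integrableOn_rpow_mul_exp_neg_mul_rpow (s := 1) (by norm_num) one_pos hx
      simpa [mul_comm] using this
    refine (h1.add (hexp x hx)).congr (Eventually.of_forall fun s => ?_)
    simp only [Pi.add_apply]
    ring
  have hint : Integrable (Function.uncurry K) ((volume.restrict (Ioi 0)).prod ρ) := by
    refine (hsexp.mul_prod (integrable_const (1 : ℝ) (μ := ρ))).mono' (by fun_prop) ?_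
    have h1 : ∀ᵐ p ∂((volume.restrict (Ioi (0 : ℝ))).prod ρ), p.1 ∈ Ioi (0 : ℝ) :=
      Measure.quasiMeasurePreserving_fst.ae (ae_restrict_mem measurableSet_Ioi)
    have h2 : ∀ᵐ p ∂((volume.restrict (Ioi (0 : ℝ))).prod ρ), 0 < p.2 :=
      Measure.quasiMeasurePreserving_snd.ae hρ
    filter_upwards [h1, h2] with p hp1 hp2
    simp only [Function.uncurry, hK, mul_one]
    rw [norm_mul, Real.norm_of_nonneg (Real.exp_pos _).le,
      Real.norm_of_nonneg (Real.one_sub_exp_mul_nonneg hp2 (le_of_lt hp1))]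
    exact mul_le_mul_of_nonneg_left (Real.one_sub_exp_mul_le hp2) (Real.exp_pos _).le
  have hKφ : ∀ s, ∫ l, K s l ∂ρ = Real.exp (-(s * x)) * expMixture ρ s := fun s =>
    integral_const_mul _ _
  refine ⟨by
    have h := hint.integral_prod_left
    simp only [Function.uncurry, hKφ] at h
    exact h, ?_⟩
  simp_rw [← hKφ]
  rw [integral_integral_swap hint, hf x hx, ← integral_const_mul]
  refine integral_congr_ae ?_
  filter_upwards [hρ] with l hl
  have h3 : ∀ s, K s l = (Real.exp (-(s * x)) - Real.exp (-(s * (x + l)))) * ((1 + l) / l) := by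
    intro s
    have : Real.exp (-(s * (x + l))) = Real.exp (-(s * x)) * Real.exp (-(l * s)) := by
      rw [← Real.exp_add]; ring_nf
    rw [this]
    simp only [hK]
    ring
  simp_rw [h3]
  rw [integral_mul_const, integral_sub (hexp x hx) (hexp (x + l) (by linarith)), hexpval x hx,
    hexpval (x + l) (by linarith)]
  have : x + l ≠ 0 := by linarith
  field_simp
  ring

end Bernstein

/-! ### The representing measure near the endpoints of `[0, 1]`. -/

theorem isCompleteBernstein_of_eq_integral_Ioo {ν : Measure ℝ} (hν : ∀ᵐ x ∂ν, x ∈ Ioo (0 : ℝ) 1)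
    (h0 : Integrable (fun x => x⁻¹) ν) (h1 : Integrable (fun x => (1 - x)⁻¹) ν) {f : ℝ → ℝ}
    (hf : ∀ t, 0 < t → f t = ∫ x, (x⁻¹ + (1 - x)⁻¹) * (t / (1 + (t - 1) * x)) ∂ν) :
    IsCompleteBernstein f := by
  set d : ℝ → ℝ := fun x => x⁻¹ + (1 - x)⁻¹ with hd
  have hdm : Measurable d := by fun_prop
  have hdpos : ∀ᵐ x ∂ν, 0 ≤ d x := hν.mono fun x hx =>
    add_nonneg (inv_nonneg.2 hx.1.le) (inv_nonneg.2 (sub_nonneg.2 hx.2.le))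
  set ν' := ν.withDensity fun x => ENNReal.ofReal (d x)
  have : IsFiniteMeasure ν' := isFiniteMeasure_withDensity_ofReal (h0.add h1).2
  have hν' : ∀ᵐ x ∂ν', x ∈ Ioo (0 : ℝ) 1 := (withDensity_absolutelyContinuous _ _).ae_le hν
  -- With `l = (1 - x)/x` one has `x = 1/(1 + l)` and `1 + (t - 1) x = x (t + l)`.
  have hg : Measurable fun x : ℝ => (1 - x) / x := by fun_prop
  refine isCompleteBernstein_of_eq_integral (ρ := ν'.map fun x => (1 - x) / x) ?_ fun t ht => ?_
  · rw [ae_map_iff hg.aemeasurable measurableSet_Ioi]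
    exact hν'.mono fun x hx => div_pos (sub_pos.2 hx.2) hx.1
  · have hgt : Measurable fun l : ℝ => (1 + l) * t / (t + l) := by fun_prop
    rw [integral_map hg.aemeasurable hgt.aestronglyMeasurable, hf t ht,
      integral_withDensity_eq_integral_toReal_smul (by fun_prop) (by simp)]
    refine integral_congr_ae ?_
    filter_upwards [hν, hdpos] with x hx hdx
    rw [ENNReal.toReal_ofReal hdx, smul_eq_mul]
    congr 1
    have hx0 : x ≠ 0 := hx.1.ne'
    have h3 : 1 + (t - 1) * x ≠ 0 := by nlinarith [hx.1, hx.2, mul_pos ht hx.1]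
    have h4 : t + (1 - x) / x ≠ 0 := (add_pos ht (div_pos (sub_pos.2 hx.2) hx.1)).ne'
    have h5 : t * x + (1 - x) ≠ 0 := by convert h3 using 1; ring
    field_simp
    ring

/-- Fatou makes `1/g` integrable, hence `g > 0` almost everywhere; then `1/g` dominates every `1/E
n` and identifies the limit. -/
theorem integrable_inv_of_tendsto_integral_inv {ν : Measure ℝ} {g : ℝ → ℝ} (hg : Measurable g)
    {E : ℕ → ℝ → ℝ} (hE0 : ∀ n, ∀ᵐ x ∂ν, 0 < E n x)
    (hEg : ∀ n, ∀ᵐ x ∂ν, g x ≤ E n x)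
    (hlim : ∀ᵐ x ∂ν, Tendsto (fun n => E n x) atTop (𝓝 (g x)))
    (hint : ∀ n, Integrable (fun x => (E n x)⁻¹) ν) {c : ℝ}
    (hc : Tendsto (fun n => ∫ x, (E n x)⁻¹ ∂ν) atTop (𝓝 c)) :
    (∀ᵐ x ∂ν, 0 < g x) ∧ Integrable (fun x => (g x)⁻¹) ν ∧ ∫ x, (g x)⁻¹ ∂ν = c := by
  have hfatou : ∫⁻ x, (ENNReal.ofReal (g x))⁻¹ ∂ν ≤ ENNReal.ofReal c := by
    calc ∫⁻ x, (ENNReal.ofReal (g x))⁻¹ ∂ν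
        = ∫⁻ x, liminf (fun n => ENNReal.ofReal (E n x)⁻¹) atTop ∂ν := by
          refine lintegral_congr_ae ?_
          filter_upwards [hlim, ae_all_iff.2 hE0] with x hx h0
          have : Tendsto (fun n => ENNReal.ofReal (E n x)⁻¹) atTop (𝓝 (ENNReal.ofReal (g x))⁻¹) := by
            simp_rw [fun n => ENNReal.ofReal_inv_of_pos (h0 n)]
            exact (ENNReal.tendsto_ofReal hx).inv
          exact this.liminf_eq.symm
      _ ≤ liminf (fun n => ∫⁻ x, ENNReal.ofReal (E n x)⁻¹ ∂ν) atTop :=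
          lintegral_liminf_le' fun n => (hint n).aemeasurable.ennreal_ofReal
      _ = ENNReal.ofReal c := by
          simp_rw [fun n => (ofReal_integral_eq_lintegral_ofReal (hint n)
            ((hE0 n).mono fun x hx => (inv_pos.2 hx).le)).symm]
          exact (ENNReal.tendsto_ofReal hc).liminf_eq
  have hpos : ∀ᵐ x ∂ν, 0 < g x := by
    filter_upwards [ae_lt_top (by fun_prop) (hfatou.trans_lt ENNReal.ofReal_lt_top).ne] with x hx
    simpa using hx
  have hInt : Integrable (fun x => (g x)⁻¹) ν := by
    refine ⟨hg.inv.aestronglyMeasurable, ?_⟩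
    rw [hasFiniteIntegral_iff_ofReal (hpos.mono fun x hx => (inv_pos.2 hx).le),
      lintegral_congr_ae (hpos.mono fun x hx => ENNReal.ofReal_inv_of_pos hx)]
    exact hfatou.trans_lt ENNReal.ofReal_lt_top
  refine ⟨hpos, hInt, tendsto_nhds_unique ?_ hc⟩
  refine tendsto_integral_of_dominated_convergence _ (fun n => (hint n).1) hInt (fun n => ?_) ?_
  · filter_upwards [hpos, hEg n] with x h1 h2
    rw [Real.norm_of_nonneg (inv_pos.2 (h1.trans_le h2)).le]
    exact inv_anti₀ h1 h2
  · filter_upwards [hpos, hlim] with x h1 h2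
    exact h2.inv₀ h1.ne'

theorem one_add_sub_one_mul_pos {t x : ℝ} (ht : 0 < t) (hx : x ∈ Icc (0 : ℝ) 1) :
    0 < 1 + (t - 1) * x ∧ min t 1 ≤ 1 + (t - 1) * x := by
  have : min t 1 ≤ 1 + (t - 1) * x := by
    rcases le_total t 1 with h | h
    · rw [min_eq_left h]; nlinarith [hx.1, hx.2]
    · rw [min_eq_right h]; nlinarith [hx.1, hx.2]
  exact ⟨(lt_min ht one_pos).trans_le this, this⟩

theorem integrable_inv_one_add_sub_one_mul {ν : Measure ℝ} [IsFiniteMeasure ν]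
    (hν : ∀ᵐ x ∂ν, x ∈ Icc (0 : ℝ) 1) {t : ℝ} (ht : 0 < t) :
    Integrable (fun x => (1 + (t - 1) * x)⁻¹) ν := by
  refine Integrable.of_bound (by fun_prop) (min t 1)⁻¹ (hν.mono fun x hx => ?_)
  obtain ⟨h1, h2⟩ := one_add_sub_one_mul_pos ht hx
  rw [Real.norm_of_nonneg (inv_pos.2 h1).le]
  exact inv_anti₀ (lt_min ht one_pos) h2

theorem isCompleteBernstein_sub_of_resolvent_form {ν : Measure ℝ} [IsFiniteMeasure ν]
    (hν : ∀ᵐ x ∂ν, x ∈ Icc (0 : ℝ) 1) {r : ℝ → ℝ} {A B h : ℝ}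
    (hr : ∀ t, 0 < t → r t = A + (t - 1) * B - (t - 1) ^ 2 * ∫ x, (1 + (t - 1) * x)⁻¹ ∂ν)
    (hinf : Tendsto (fun n : ℕ => r (n + 2) / (n + 2)) atTop (𝓝 1))
    (hzero : Tendsto (fun n : ℕ => r ((n + 2 : ℝ)⁻¹)) atTop (𝓝 h)) :
    IsCompleteBernstein fun t => r t - t - h := by
  have hn : Tendsto (fun n : ℕ => ((n : ℝ) + 2)⁻¹) atTop (𝓝 0) :=
    (tendsto_atTop_add_const_right _ _ tendsto_natCast_atTop_atTop).inv_tendsto_atTop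
  have hn1 : Tendsto (fun n : ℕ => ((n : ℝ) + 1)⁻¹) atTop (𝓝 0) :=
    (tendsto_atTop_add_const_right _ _ tendsto_natCast_atTop_atTop).inv_tendsto_atTop
  have hint : ∀ t, 0 < t → (t - 1) ^ 2 * ∫ x, (1 + (t - 1) * x)⁻¹ ∂ν = A + (t - 1) * B - r t :=
    fun t ht => by rw [hr t ht]; ring
  have hE1 : ∀ (n : ℕ) (x : ℝ), ((1 + ((n : ℝ) + 1)⁻¹) * (x + ((n : ℝ) + 1)⁻¹))⁻¹ =
      ((n : ℝ) + 2)⁻¹ * ((((n : ℝ) + 2) - 1) ^ 2 * (1 + (((n : ℝ) + 2) - 1) * x)⁻¹) := by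
    intro n x
    have : (1 + ((n : ℝ) + 1)⁻¹) * (x + ((n : ℝ) + 1)⁻¹) =
        ((n : ℝ) + 2) * (((((n : ℝ) + 2) - 1) ^ 2)⁻¹ * (1 + (((n : ℝ) + 2) - 1) * x)) := by
      have h2 : (n : ℝ) + 2 - 1 = n + 1 := by ring
      rw [h2]
      field_simp
      ring
    rw [this, mul_inv, mul_inv, inv_inv]
  -- At `t = n + 2`, `E n x` is `t (1 + (t - 1) x) / (t - 1)²`; the shift by 2 keeps `t ≠ 1`.
  obtain ⟨hx0, hi0, hB⟩ := integrable_inv_of_tendsto_integral_inv (ν := ν) (g := fun x => x)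
    (E := fun n x => (1 + ((n : ℝ) + 1)⁻¹) * (x + ((n : ℝ) + 1)⁻¹)) (c := B - 1) measurable_id
    (fun n => hν.mono fun x hx => by have := hx.1; positivity)
    (fun n => hν.mono fun x hx => by
      have h1 : (0 : ℝ) ≤ ((n : ℝ) + 1)⁻¹ := by positivity
      nlinarith [mul_nonneg h1 hx.1])
    (Eventually.of_forall fun x => by
      simpa using (hn1.const_add 1).mul (hn1.const_add x))
    (fun n => by
      simp_rw [hE1]
      exact ((integrable_inv_one_add_sub_one_mul hν (by positivity)).const_mul _).const_mul _)
    (by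
      simp_rw [hE1, integral_const_mul]
      have h2 := ((hn.mul_const (A - B)).add_const B).sub hinf
      rw [zero_mul, zero_add] at h2
      refine h2.congr fun n => ?_
      rw [hint _ (by positivity)]
      field_simp
      ring)
  have hs : ∀ n : ℕ, 0 < ((n : ℝ) + 2)⁻¹ ∧ ((n : ℝ) + 2)⁻¹ < 1 := fun n =>
    ⟨by positivity, inv_lt_one_of_one_lt₀ (by linarith [n.cast_nonneg (α := ℝ)])⟩
  -- The same argument as `t = 1/(n + 2)` tends to zero, for the endpoint `x = 1`.
  obtain ⟨hx1, hi1, hA⟩ := integrable_inv_of_tendsto_integral_inv (ν := ν) (g := fun x => 1 - x)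
    (E := fun n x => (1 + (((n : ℝ) + 2)⁻¹ - 1) * x) / (((n : ℝ) + 2)⁻¹ - 1) ^ 2) (c := A - B - h)
    (by fun_prop)
    (fun n => hν.mono fun x hx => div_pos (one_add_sub_one_mul_pos (hs n).1 hx).1
      (sq_pos_of_neg (sub_neg.2 (hs n).2)))
    (fun n => hν.mono fun x hx => by
      obtain ⟨h1, h2⟩ := hs n
      rw [le_div_iff₀ (sq_pos_of_neg (sub_neg.2 h2))]
      have h3 : (((n : ℝ) + 2)⁻¹ - 1) ^ 2 ≤ 1 := by nlinarith
      nlinarith [mul_le_mul_of_nonneg_left h3 (sub_nonneg.2 hx.2), mul_nonneg h1.le hx.1])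
    (Eventually.of_forall fun x => by
      have := (((hn.sub_const 1).mul_const x).const_add 1).div ((hn.sub_const 1).pow 2) (by norm_num)
      rw [show (1 + (0 - 1) * x) / (0 - 1) ^ 2 = 1 - x by ring] at this
      exact this)
    (fun n => by
      simp_rw [inv_div, div_eq_mul_inv]
      exact (integrable_inv_one_add_sub_one_mul hν (hs n).1).const_mul _)
    (by
      simp_rw [inv_div, div_eq_mul_inv, integral_const_mul]
      have h2 := ((((hn.sub_const 1).mul_const B)).const_add A).sub hzero
      rw [show A + (0 - 1) * B - h = A - B - h by ring] at h2
      exact h2.congr fun n => (hint _ (hs n).1).symm)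
  refine isCompleteBernstein_of_eq_integral_Ioo (ν := ν)
    (by filter_upwards [hx0, hx1] with x h0 h1 using ⟨h0, sub_pos.1 h1⟩) hi0 hi1 fun t ht => ?_
  have hit := (integrable_inv_one_add_sub_one_mul hν ht).const_mul ((t - 1) ^ 2)
  have hadd : Integrable (fun x => t * x⁻¹ + (1 - x)⁻¹) ν := (hi0.const_mul t).add hi1
  have hB' : B = 1 + ∫ x, x⁻¹ ∂ν := by rw [hB]; ring
  have hA' : A = 1 + ∫ x, x⁻¹ ∂ν + h + ∫ x, (1 - x)⁻¹ ∂ν := by rw [hB, hA]; ring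
  calc r t - t - h = t * ∫ x, x⁻¹ ∂ν + ∫ x, (1 - x)⁻¹ ∂ν -
        (t - 1) ^ 2 * ∫ x, (1 + (t - 1) * x)⁻¹ ∂ν := by
        rw [hr t ht, hA', hB']; ring
    _ = ∫ x, (t * x⁻¹ + (1 - x)⁻¹ - (t - 1) ^ 2 * (1 + (t - 1) * x)⁻¹) ∂ν := by
        rw [integral_sub hadd hit, integral_add (hi0.const_mul t) hi1,
          integral_const_mul, integral_const_mul]
    _ = _ := by
        refine integral_congr_ae ?_
        filter_upwards [hν, hx0, hx1] with x hx h0 h1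
        have h3 := (one_add_sub_one_mul_pos ht hx).1.ne'
        have h4 := h0.ne'
        have h5 := h1.ne'
        generalize hD : 1 + (t - 1) * x = D at h3 ⊢
        field_simp
        rw [← hD]
        ring

/-! ### Averaged resolvents and the theorem. -/

theorem isCompleteBernstein_inv_integral_resolvent {Ω : Type*} [MeasurableSpace Ω] {P : Measure Ω}
    [IsProbabilityMeasure P] {Y : Ω → ℝ} (hY : AEMeasurable Y P) (hY0 : ∀ᵐ x ∂P, 0 ≤ Y x) :
    IsCompleteBernstein fun t => (∫ x, (Y x + t)⁻¹ ∂P)⁻¹ - t -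
      ((∫⁻ x, (ENNReal.ofReal (Y x))⁻¹ ∂P)⁻¹).toReal := by
  set W : Ω → ℝ := fun x => (1 + Y x)⁻¹ with hWdef
  have hW : AEMeasurable W P := (hY.const_add 1).inv
  have hW0 : ∀ᵐ x ∂P, 0 < W x := hY0.mono fun x hx => by positivity
  have hW1 : ∀ᵐ x ∂P, W x ≤ 1 := hY0.mono fun x hx => inv_le_one_of_one_le₀ (by linarith)
  have hWint : Integrable W P := Integrable.of_bound hW.aestronglyMeasurable 1 (by
    filter_upwards [hW0, hW1] with x h0 h1
    rwa [Real.norm_of_nonneg h0.le])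
  -- The density cancels the extra factor in `1 + (t - 1) W = (Y + t) W`.
  set m := P.withDensity fun x => ENNReal.ofReal (W x) with hmdef
  have : IsFiniteMeasure m := isFiniteMeasure_withDensity_ofReal hWint.2
  have hac : m ≪ P := withDensity_absolutelyContinuous _ _
  have hm0 : m ≠ 0 := by
    intro h
    have : ∀ᵐ x ∂P, ENNReal.ofReal (W x) = 0 := by
      exact (withDensity_eq_zero_iff hW.ennreal_ofReal).1 h
    have hF : ∀ᵐ x ∂P, False := by
      filter_upwards [this, hW0] with x h1 h2
      rw [ENNReal.ofReal_eq_zero] at h1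
      linarith
    simp at hF
    exact IsProbabilityMeasure.ne_zero P hF
  obtain ⟨ν, hν, hsupp, A, B, hAB⟩ := exists_measure_inv_integral_resolvent hm0 (hW.mono_ac hac)
    (hac.ae_le (by filter_upwards [hW0, hW1] with x h0 h1 using ⟨h0.le, h1⟩))
  have hG : ∀ t, 0 < t → ∫ x, (1 + (t - 1) * W x)⁻¹ ∂m = ∫ x, (Y x + t)⁻¹ ∂P := by
    intro t ht
    rw [hmdef, integral_withDensity_eq_integral_toReal_smul₀ hW.ennreal_ofReal (by simp)]
    refine integral_congr_ae ?_
    filter_upwards [hY0, hW0] with x h0 h1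
    rw [ENNReal.toReal_ofReal h1.le, smul_eq_mul]
    have h3 : Y x + t ≠ 0 := by positivity
    have h4 : 1 + Y x ≠ 0 := by positivity
    have h5 : 1 + (t - 1) * W x = (Y x + t) * W x := by
      simp only [hWdef]
      field_simp
      ring
    rw [h5, mul_inv, mul_left_comm, mul_inv_cancel₀ h1.ne', mul_one]
  have hYint : ∀ t, 0 < t → Integrable (fun x => (Y x + t)⁻¹) P := fun t ht =>
    Integrable.of_bound (hY.add_const t).inv.aestronglyMeasurable t⁻¹ (hY0.mono fun x hx => by
      rw [Real.norm_of_nonneg (by positivity)]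
      exact inv_anti₀ ht (by linarith))
  have hof : ∀ t, 0 < t → ENNReal.ofReal (∫ x, (Y x + t)⁻¹ ∂P) =
      ∫⁻ x, (ENNReal.ofReal (Y x + t))⁻¹ ∂P := fun t ht => by
    rw [ofReal_integral_eq_lintegral_ofReal (hYint t ht) (hY0.mono fun x hx => by positivity)]
    exact lintegral_congr_ae (hY0.mono fun x hx => ENNReal.ofReal_inv_of_pos (by positivity))
  have hn : Tendsto (fun n : ℕ => ((n : ℝ) + 2)⁻¹) atTop (𝓝 0) :=
    (tendsto_atTop_add_const_right _ _ tendsto_natCast_atTop_atTop).inv_tendsto_atTop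
  refine isCompleteBernstein_sub_of_resolvent_form hsupp (A := A) (B := B)
    (fun t ht => by rw [← hG t ht, hAB t ht]) ?_ ?_
  · have h1 : Tendsto (fun n : ℕ => ∫ x, (1 + Y x * ((n : ℝ) + 2)⁻¹)⁻¹ ∂P) atTop (𝓝 (∫ _, 1 ∂P)) := by
      refine tendsto_integral_of_dominated_convergence (fun _ => 1)
        (fun n => (((hY.mul_const _).const_add 1).inv).aestronglyMeasurable) (integrable_const _)
        (fun n => hY0.mono fun x hx => ?_) (Eventually.of_forall fun x => ?_)
      · rw [Real.norm_of_nonneg (by positivity)]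
        exact inv_le_one_of_one_le₀ (le_add_of_nonneg_right (by positivity))
      · have := ((hn.const_mul (Y x)).const_add 1).inv₀ (by simp)
        simpa using this
    have h2 := h1.inv₀ (by simp)
    simp only [integral_const, probReal_univ, smul_eq_mul, mul_one, inv_one] at h2
    refine h2.congr fun n => ?_
    rw [div_eq_mul_inv, ← mul_inv, ← integral_mul_const]
    congr 1
    refine integral_congr_ae (hY0.mono fun x hx => ?_)
    have h3 : Y x + (n + 2) ≠ 0 := by positivity
    have h4 : 1 + Y x * ((n : ℝ) + 2)⁻¹ ≠ 0 := by positivity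
    field_simp
    ring
  -- Monotone convergence in `[0, ∞]` also covers an infinite limit, where the inverse is `0`.
  · have hlim : Tendsto (fun n : ℕ => ∫⁻ x, (ENNReal.ofReal (Y x + ((n : ℝ) + 2)⁻¹))⁻¹ ∂P) atTop
        (𝓝 (∫⁻ x, (ENNReal.ofReal (Y x))⁻¹ ∂P)) := by
      refine lintegral_tendsto_of_tendsto_of_monotone
        (fun n => (hY.add_const _).ennreal_ofReal.inv) (Eventually.of_forall fun x i j hij => ?_)
        (Eventually.of_forall fun x => ?_)
      · have : ((j : ℝ) + 2)⁻¹ ≤ ((i : ℝ) + 2)⁻¹ :=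
          inv_anti₀ (by positivity) (by have : (i : ℝ) ≤ j := by exact_mod_cast hij
                                        linarith)
        simp only
        gcongr
      · have := hn.const_add (Y x)
        rw [add_zero] at this
        exact (ENNReal.tendsto_ofReal this).inv
    have hne : (∫⁻ x, (ENNReal.ofReal (Y x))⁻¹ ∂P) ≠ 0 := by
      intro h
      have hF : ∀ᵐ x ∂P, False :=
        ((lintegral_eq_zero_iff' hY.ennreal_ofReal.inv).1 h).mono fun x hx => by simp at hx
      simp at hF
      exact IsProbabilityMeasure.ne_zero P hF
    refine ((ENNReal.tendsto_toReal (ENNReal.inv_ne_top.2 hne)).comp hlim.inv).congr fun n => ?_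
    simp only [Function.comp_apply]
    rw [← hof _ (by positivity), ENNReal.toReal_inv, ENNReal.toReal_ofReal]
    exact integral_nonneg_of_ae (hY0.mono fun x hx => by positivity)

theorem theorem3p3 (I : Set ℝ) (hI : I.OrdConnected) (F : StieltjesFunction ℝ)
    (hF : ProfitGame.dF F I univ = 1) (a : ℝ → ℝ)
    (ha : AEMeasurable a (ProfitGame.dF F I))
    (hconst : ¬ ∃ k : ℝ, ∀ᵐ x ∂(ProfitGame.dF F I), a x = k)
    (hbdd : ∃ k : ℝ, ∀ᵐ x ∂(ProfitGame.dF F I), k ≤ a x) :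
    IsCompleteBernstein (fun t : ℝ =>
      ProfitGame.Psi F I a (t - ProfitGame.xi F I a) - ProfitGame.xi F I a
        - ((ProfitGame.H F I a)⁻¹).toReal) := by
  have : IsProbabilityMeasure (ProfitGame.dF F I) := ⟨hF⟩
  have hxi : ∀ᵐ x ∂(ProfitGame.dF F I), 0 ≤ a x - ProfitGame.xi F I a := by
    obtain ⟨k, hk⟩ := hbdd
    have h : ∀ᵐ x ∂(ProfitGame.dF F I), essInf a (ProfitGame.dF F I) ≤ a x := ae_essInf_le ⟨k, hk⟩
    exact h.mono fun x hx => sub_nonneg.2 hx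
  convert isCompleteBernstein_inv_integral_resolvent (ha.sub_const _) hxi using 2 with t
  have h : ∀ x, a x + (t - ProfitGame.xi F I a) = a x - ProfitGame.xi F I a + t := fun x => by ring
  simp only [ProfitGame.Psi, ProfitGame.H, h]
  ring
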